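/- Let $k$ be a field and let $Q$ be a finite quiver (finitely many vertices and arrows) with path algebra $kQ$; for $t\ge 0$ let $Q_{\ge t}$ denote the two-sided ideal of $kQ$ generated by all paths of length $t$. Let $I$ be a two-sided ideal of $kQ$ which is admissible, i.e. $Q_{\ge t}\subseteq I\subseteq Q_{\ge 2}$ for some $t\ge 2$, and which can be generated by paths, so that $\Lambda=kQ/I$ is a (finite dimensional) monomial algebra. Assume that $\Lambda$ has finite global dimension, i.e. the projective dimensions of the finitely generated left $\Lambda$-modules are bounded. Then $w^2\in I$ for every oriented cycle $w$ of $Q$, i.e. for every path $w$ of length at least $1$ whose starting point and end point coincide. -/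

import Mathlib

open CategoryTheory

universe u v w

/-- The paths of a quiver, with arbitrary endpoints. They include the trivial path of
length `0` at every vertex. -/
structure QuiverPath (V : Type u) [Quiver.{v} V] : Type (max u v) where
  /-- the starting point -/
  src : V
  /-- the end point -/
  tgt : V
  /-- the path itself -/
  path : Quiver.Path src tgt

/-- The path algebra `kQ` as a vector space: it has the paths of the quiver as a basis. -/
def PathAlgebra (k : Type w) [Field k] (V : Type u) [Quiver.{v} V] : Type (max u v w) :=
  QuiverPath V →₀ k

namespace PathAlgebra

noncomputable section

variable {k : Type w} [Field k] {V : Type u} [Quiver.{v} V]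

instance instAddCommGroup : AddCommGroup (PathAlgebra k V) :=
  inferInstanceAs (AddCommGroup (QuiverPath V →₀ k))

instance instModule : Module k (PathAlgebra k V) :=
  inferInstanceAs (Module k (QuiverPath V →₀ k))

/-- The basis element of `kQ` given by a path. -/
def ofQuiverPath (k : Type w) [Field k] (p : QuiverPath V) : PathAlgebra k V :=
  (Finsupp.single p 1 : QuiverPath V →₀ k)

/-- The basis element of `kQ` given by a path from `a` to `b`. -/
def ofPath (k : Type w) [Field k] {a b : V} (p : Quiver.Path a b) : PathAlgebra k V :=
  ofQuiverPath k ⟨a, b, p⟩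

/-- Two linear maps on `kQ` agree if they agree on paths. -/
theorem linearMap_ext {M : Type*} [AddCommGroup M] [Module k M]
    {f g : PathAlgebra k V →ₗ[k] M}
    (h : ∀ (a b : V) (p : Quiver.Path a b), f (ofPath k p) = g (ofPath k p)) : f = g :=
  Finsupp.lhom_ext' fun p => LinearMap.ext_ring (h p.src p.tgt p.path)

/-- The unit of `kQ` is the sum of the trivial paths. -/
instance instOne [Fintype V] : One (PathAlgebra k V) := ⟨∑ a : V, ofPath k (Quiver.Path.nil : Quiver.Path a a)⟩

theorem one_def [Fintype V] :
    (1 : PathAlgebra k V) = ∑ a : V, ofPath k (Quiver.Path.nil : Quiver.Path a a) := rfl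

variable [DecidableEq V]

/-- The product of two paths: first `p`, then `q`, if `p` ends where `q` starts, and `0`
otherwise. -/
def pathMul (k : Type w) [Field k] (p q : QuiverPath V) : PathAlgebra k V :=
  if h : p.tgt = q.src then ofPath k ((p.path.cast rfl h).comp q.path) else 0

/-- The multiplication of `kQ`, the bilinear extension of the product of paths. -/
def mulLin : PathAlgebra k V →ₗ[k] PathAlgebra k V →ₗ[k] PathAlgebra k V :=
  Finsupp.linearCombination k fun p : QuiverPath V =>
    (Finsupp.linearCombination k fun q : QuiverPath V => pathMul k p q :
      (QuiverPath V →₀ k) →ₗ[k] PathAlgebra k V)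

instance instMul : Mul (PathAlgebra k V) := ⟨fun x y => mulLin x y⟩

theorem mul_def (x y : PathAlgebra k V) : x * y = mulLin x y := rfl

theorem ofQuiverPath_mul (p q : QuiverPath V) :
    ofQuiverPath k p * ofQuiverPath k q = pathMul k p q := by
  rw [mul_def, mulLin, ofQuiverPath, ofQuiverPath]
  erw [Finsupp.linearCombination_single, one_smul, Finsupp.linearCombination_single, one_smul]

theorem ofPath_mul_ofPath {a b c : V} (p : Quiver.Path a b) (q : Quiver.Path b c) :
    ofPath k p * ofPath k q = ofPath k (p.comp q) := by
  rw [ofPath, ofPath, ofQuiverPath_mul, pathMul, dif_pos rfl]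
  rfl

theorem ofPath_mul_ofPath_of_ne {a b c d : V} (p : Quiver.Path a b) (q : Quiver.Path c d)
    (h : b ≠ c) : ofPath k p * ofPath k q = 0 := by
  rw [ofPath, ofPath, ofQuiverPath_mul, pathMul, dif_neg h]

theorem path_mul_assoc {a b c d e f : V} (p : Quiver.Path a b) (q : Quiver.Path c d)
    (r : Quiver.Path e f) :
    mulLin (mulLin (ofPath k p) (ofPath k q)) (ofPath k r) =
      mulLin (ofPath k p) (mulLin (ofPath k q) (ofPath k r)) := by
  simp only [← mul_def]
  have hz : ∀ x : PathAlgebra k V, 0 * x = 0 ∧ x * 0 = 0 := fun x => by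
    simp [mul_def]
  by_cases h₁ : b = c
  · subst h₁
    by_cases h₂ : d = e
    · subst h₂
      simp [ofPath_mul_ofPath, Quiver.Path.comp_assoc]
    · simp [ofPath_mul_ofPath, ofPath_mul_ofPath_of_ne _ _ h₂, hz]
  · by_cases h₂ : d = e
    · subst h₂
      simp [ofPath_mul_ofPath, ofPath_mul_ofPath_of_ne _ _ h₁, hz]
    · simp [ofPath_mul_ofPath_of_ne _ _ h₁, ofPath_mul_ofPath_of_ne _ _ h₂, hz]

theorem mulLin_assoc (x y z : PathAlgebra k V) :
    mulLin (mulLin x y) z = mulLin x (mulLin y z) := by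
  have H : (LinearMap.llcomp k (PathAlgebra k V) (PathAlgebra k V) (PathAlgebra k V →ₗ[k]
        PathAlgebra k V) mulLin) ∘ₗ mulLin =
      (LinearMap.llcomp k _ _ _).flip mulLin ∘ₗ (LinearMap.llcomp k _ _ _) ∘ₗ
        (mulLin : PathAlgebra k V →ₗ[k] PathAlgebra k V →ₗ[k] PathAlgebra k V) := by
    refine linearMap_ext fun a b p => linearMap_ext fun c d q => linearMap_ext fun e f r => ?_
    exact path_mul_assoc p q r
  exact LinearMap.congr_fun (LinearMap.congr_fun (LinearMap.congr_fun H x) y) z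

variable [Fintype V]

theorem one_mulLin (x : PathAlgebra k V) : mulLin 1 x = x := by
  have H : mulLin (1 : PathAlgebra k V) = LinearMap.id := by
    refine linearMap_ext fun a b p => ?_
    rw [one_def, map_sum, LinearMap.sum_apply, Finset.sum_eq_single a]
    · rw [← mul_def, ofPath_mul_ofPath, Quiver.Path.nil_comp, LinearMap.id_apply]
    · intro c _ hc
      rw [← mul_def, ofPath_mul_ofPath_of_ne _ _ hc]
    · simp
  rw [H, LinearMap.id_apply]

theorem mulLin_one (x : PathAlgebra k V) : mulLin x 1 = x := by
  have H : mulLin.flip (1 : PathAlgebra k V) = LinearMap.id := by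
    refine linearMap_ext fun a b p => ?_
    rw [LinearMap.flip_apply, one_def, map_sum, Finset.sum_eq_single b]
    · rw [← mul_def, ofPath_mul_ofPath, Quiver.Path.comp_nil, LinearMap.id_apply]
    · intro c _ hc
      rw [← mul_def, ofPath_mul_ofPath_of_ne _ _ hc.symm]
    · simp
  exact LinearMap.congr_fun H x

instance instRing : Ring (PathAlgebra k V) :=
  { instAddCommGroup, instMul, instOne with
    left_distrib := fun x y z => (mulLin x).map_add y z
    right_distrib := fun x y z => by simp [mul_def]
    zero_mul := fun x => by simp [mul_def]
    mul_zero := fun x => by simp [mul_def]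
    mul_assoc := mulLin_assoc
    one_mul := one_mulLin
    mul_one := mulLin_one }

instance instAlgebra : Algebra k (PathAlgebra k V) :=
  Algebra.ofModule (fun r x y => by simp [mul_def]) (fun r x y => by simp [mul_def])

/-- The two-sided ideal of `kQ` generated by all the paths of length `t`. -/
def lengthIdeal (k : Type w) [Field k] (V : Type u) [Quiver.{v} V] [DecidableEq V] [Fintype V]
    (t : ℕ) : TwoSidedIdeal (PathAlgebra k V) :=
  TwoSidedIdeal.span {x | ∃ (a b : V) (p : Quiver.Path a b), p.length = t ∧ x = ofPath k p}

/-- Admissible ideals of the path algebra. -/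
def IsAdmissible (I : TwoSidedIdeal (PathAlgebra k V)) : Prop :=
  ∃ t : ℕ, 2 ≤ t ∧ lengthIdeal k V t ≤ I ∧ I ≤ lengthIdeal k V 2

/-- A two-sided ideal that can be generated by paths. -/
def IsGeneratedByPaths (I : TwoSidedIdeal (PathAlgebra k V)) : Prop :=
  ∃ S : Set (QuiverPath V), I = TwoSidedIdeal.span (ofQuiverPath k '' S)

/-- `kQ/I` is a monomial algebra: `I` is admissible and can be generated by paths. -/
def IsMonomial (I : TwoSidedIdeal (PathAlgebra k V)) : Prop :=
  IsAdmissible I ∧ IsGeneratedByPaths I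

end

end PathAlgebra

/-- The global dimension of a ring, as the supremum of the projective dimensions of its finitely
generated left modules. -/
noncomputable def globalDimension (R : Type u) [Ring R] : WithBot ℕ∞ :=
  ⨆ M : {M : ModuleCat.{u} R // Module.Finite R M}, projectiveDimension M.1

/-! Suppose that `c` is an oriented cycle of length ℓ whose square is not in `I`. Count positions in
the left-infinite path ⋯ccc from the right, and let f(x) be the least y such that the segment [x, y)
lies in `I`; it exists because long paths lie in `I`. Then f is monotone, commutes with translation
by ℓ, and f(0) > 2ℓ, so the sequence 0, ℓ, f(0), f(ℓ), f²(0), … is strictly increasing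
(`exists_strictMono_minimal_intervals`). Let p_i be the segment between its terms i and i + 1. No
p_i lies in `I`, but p_{i+1} p_i does, and no proper right factor of p_{i+1} annihilates p_i modulo
`I`.

Over the monomial algebra Λ this minimality makes Λp_{i+1} a direct summand of the left annihilator
of p_i, which is the first syzygy of Λp_i (`hasProjectiveDimensionLT_of_minimal`). A bound n on the
projective dimension of Λp_0 thus drops by one at each step and forces Λp_n to be projective. But
Λp_n is not projective, because p_n is killed from the left by the nonzero path p_{n+1}
(`not_projective_of_mul_mem`). -/

/-! ### Projective dimension of principal left ideals. -/

/-- The principal left ideal generated by an element. -/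
abbrev principalLeftIdeal {R : Type u} [Ring R] (a : R) : Submodule R R :=
  LinearMap.range (LinearMap.toSpanSingleton R R a)

/-- If the left ideal `R b` is a direct summand of the left annihilator of `a`, then its
projective dimension is smaller than that of `R a`. -/
theorem hasProjectiveDimensionLT_principalLeftIdeal_of_retract {R : Type u} [Ring R] {a b : R}
    (hba : b * a = 0) (f : R → R) (hadd : ∀ x y, f (x + y) = f x + f y)
    (hmul : ∀ s x, x * a = 0 → f (s * x) = s * f x) (hf : ∀ x, ∃ y, y * b = f x)
    (hb : ∀ x, f (x * b) = x * b) {n : ℕ}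
    (h : HasProjectiveDimensionLT (ModuleCat.of R (principalLeftIdeal a)) (n + 2)) :
    HasProjectiveDimensionLT (ModuleCat.of R (principalLeftIdeal b)) (n + 1) := by
  let g := (LinearMap.toSpanSingleton R R a).rangeRestrict
  have hg : Function.Surjective g := LinearMap.surjective_rangeRestrict _
  have hker : ∀ x, x ∈ LinearMap.ker g ↔ x * a = 0 := fun x => by
    simp [g]
  have hfree : Projective (ModuleCat.of R R) :=
    (IsProjective.iff_projective (R := R) R).1 inferInstance
  -- Dimension shift along 0 → ann(a) → R → Ra → 0, whose middle term is free.
  have hd : HasProjectiveDimensionLT (ModuleCat.of R (LinearMap.ker g)) (n + 1) :=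
    (LinearMap.shortExact_shortComplexKer hg).hasProjectiveDimensionLT_X₁ (n + 1)
      (inferInstanceAs (HasProjectiveDimensionLT (ModuleCat.of R R) (n + 1))) h
  have hle : principalLeftIdeal b ≤ LinearMap.ker g := by
    rintro _ ⟨x, rfl⟩
    simp [hker, mul_assoc, hba]
  let i : principalLeftIdeal b →ₗ[R] LinearMap.ker g := Submodule.inclusion hle
  let r : LinearMap.ker g →ₗ[R] principalLeftIdeal b :=
    { toFun x := ⟨f x, hf x⟩
      map_add' x y := Subtype.ext (hadd x y)
      map_smul' s x := Subtype.ext (hmul s x ((hker x).1 x.2)) }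
  have hri : r ∘ₗ i = LinearMap.id := by
    ext ⟨_, x, rfl⟩
    exact hb x
  refine Retract.hasProjectiveDimensionLT (Y := ModuleCat.of R (LinearMap.ker g))
    ⟨ModuleCat.ofHom i, ModuleCat.ofHom r, ?_⟩ _
  rw [← ModuleCat.ofHom_comp, hri, ModuleCat.ofHom_id]

/-- If the left ideal `R a` is projective, then `a = u * a` for an element `u` that is killed by
the left annihilator of `a`. -/
theorem exists_mul_eq_self_of_projective_principalLeftIdeal {R : Type u} [Ring R] {a : R}
    (h : Projective (ModuleCat.of R (principalLeftIdeal a))) :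
    ∃ u, u * a = a ∧ ∀ x, x * a = 0 → x * u = 0 := by
  have := (IsProjective.iff_projective (principalLeftIdeal a)).2 h
  obtain ⟨s, hs⟩ := Module.projective_lifting_property
    (LinearMap.toSpanSingleton R R a).rangeRestrict LinearMap.id
    (LinearMap.surjective_rangeRestrict _)
  let a' : principalLeftIdeal a := ⟨a, 1, by simp⟩
  -- The element u is the image of a under a section of R → Ra.
  refine ⟨s a', congrArg Subtype.val (LinearMap.congr_fun hs a'), fun x hx => ?_⟩
  have hx' : x • a' = 0 := Subtype.ext hx
  rw [← smul_eq_mul, ← map_smul, hx', map_zero]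

/-- Over a ring of finite global dimension the projective dimensions of the principal left ideals
are bounded. -/
theorem exists_projectiveDimensionLT_of_globalDimension_lt_top {R : Type u} [Ring R]
    (h : globalDimension R < ⊤) :
    ∃ n : ℕ, ∀ a : R, HasProjectiveDimensionLT (ModuleCat.of R (principalLeftIdeal a)) (n + 1) := by
  obtain ⟨n, hn⟩ : ∃ n : ℕ, globalDimension R ≤ n := by
    generalize globalDimension R = d at h
    induction d with
    | bot => exact ⟨0, bot_le⟩
    | coe d =>
      induction d with
      | top => exact absurd h (lt_irrefl _)
      | coe d => exact ⟨d, le_rfl⟩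
  refine ⟨n, fun a => (projectiveDimension_le_iff _ n).1 (le_trans ?_ hn)⟩
  exact le_iSup (fun M : {M : ModuleCat.{u} R // Module.Finite R M} => projectiveDimension M.1)
    ⟨ModuleCat.of R (principalLeftIdeal a), inferInstance⟩

/-! ### Combinatorics of zero intervals in a periodic word. -/

/-- The combinatorics of a periodic word: if the zero intervals form a family closed under
enlarging and under translation by `ℓ`, and some interval from `0`, but not `[0, 2ℓ)`, is zero,
then there is an infinite sequence of consecutive intervals such that the union of any two
neighbours is a zero interval, which is minimal with its starting point. -/
theorem exists_strictMono_minimal_intervals {ℓ : ℕ} (hℓ : 0 < ℓ) {Z : ℕ → ℕ → Prop}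
    (hmono : ∀ {x x' y' y}, x ≤ x' → x' ≤ y' → y' ≤ y → Z x' y' → Z x y)
    (hle : ∀ {x y}, Z x y → x ≤ y)
    (hper : ∀ x y, Z (x + ℓ) (y + ℓ) ↔ Z x y) (hex : ∃ y, Z 0 y) (hZ : ¬ Z 0 (2 * ℓ)) :
    ∃ e : ℕ → ℕ, StrictMono e ∧ ∀ i, Z (e i) (e (i + 2)) ∧ ∀ y < e (i + 2), ¬ Z (e i) y := by
  classical
  have hex' : ∀ x, ∃ y, Z x y := by
    have hmul : ∀ m, ∃ y, Z (m * ℓ) y := fun m => by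
      induction m with
      | zero => simpa using hex
      | succ m ih =>
        obtain ⟨y, hy⟩ := ih
        exact ⟨y + ℓ, by rw [Nat.succ_mul]; exact (hper _ _).2 hy⟩
    intro x
    -- Since x ≤ xℓ, a zero interval starting at xℓ can be enlarged to start at x.
    obtain ⟨y, hy⟩ := hmul x
    exact ⟨y, hmono (Nat.le_mul_of_pos_right x hℓ) (hle hy) le_rfl hy⟩
  let f : ℕ → ℕ := fun x => Nat.find (hex' x)
  have hf : ∀ x, Z x (f x) := fun x => Nat.find_spec (hex' x)
  have hfmin : ∀ x y, Z x y → f x ≤ y := fun x y h => Nat.find_min' (hex' x) h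
  have hfm : Monotone f := fun x y hxy => hfmin _ _ (hmono hxy (hle (hf y)) le_rfl (hf y))
  have hshift : ∀ x, f (x + ℓ) = f x + ℓ := by
    intro x
    refine le_antisymm (hfmin _ _ ((hper _ _).2 (hf x))) ?_
    have h1 := hle (hf (x + ℓ))
    -- By `h1` the value is at least ℓ, so the zero interval can be translated back by ℓ.
    obtain ⟨y, hy⟩ : ∃ y, f (x + ℓ) = y + ℓ := ⟨f (x + ℓ) - ℓ, by omega⟩
    have h2 := hf (x + ℓ)
    rw [hy, hper] at h2
    rw [hy]
    exact Nat.add_le_add_right (hfmin _ _ h2) ℓ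
  have h0 : 2 * ℓ < f 0 := by
    by_contra h
    exact hZ (hmono le_rfl (Nat.zero_le _) (not_lt.1 h) (hf 0))
  have hiter : ∀ n, f^[n] 0 + 2 * ℓ ≤ f (f^[n] 0) := fun n => by
    induction n with
    | zero => simpa using h0.le
    | succ n ih =>
      rw [Function.iterate_succ_apply']
      have := hfm ih
      rwa [two_mul, ← add_assoc, hshift, hshift, add_assoc, ← two_mul] at this
  -- The interleaved orbits of 0 and ℓ under f: the second is the first translated by ℓ, and it fits
  -- strictly in between because f advances the first by at least 2ℓ.
  let e : ℕ → ℕ := fun i => f^[i / 2] (i % 2 * ℓ)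
  have hstep : ∀ i, e (i + 2) = f (e i) := fun i => by
    simp [e, Function.iterate_succ_apply', Nat.add_div_right]
  have hodd : ∀ n, f^[n] ℓ = f^[n] 0 + ℓ := fun n => by
    induction n with
    | zero => simp
    | succ n ih => rw [Function.iterate_succ_apply', Function.iterate_succ_apply', ih, hshift]
  refine ⟨e, strictMono_nat_of_lt_succ fun i => ?_, fun i => ⟨hstep i ▸ hf _, fun y hy h => ?_⟩⟩
  · obtain ⟨n, rfl | rfl⟩ := Nat.even_or_odd' i
    · have h1 : (2 * n + 1) / 2 = n := by omega
      simp [e, h1, hodd, hℓ]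
    · have h1 : (2 * n + 1) / 2 = n := by omega
      have h2 : (2 * n + 1 + 1) / 2 = n + 1 := by omega
      have h3 : (2 * n + 1 + 1) % 2 = 0 := by omega
      have h4 := hiter n
      simp only [e, h1, h2, h3, Nat.mul_add_mod, Nat.one_mod, one_mul, zero_mul, hodd,
        Function.iterate_succ_apply']
      omega
  · rw [hstep] at hy
    exact absurd (hfmin _ _ h) (not_le.2 hy)

/-! ### Right factors of paths and of periodic paths. -/

namespace Quiver.Path

variable {V : Type u} [Quiver.{v} V]

/-- Of two right factors of a path, one is a right factor of the other. -/
theorem right_factor_total {a b b' c : V} (s : Path a b) (r : Path b c) (s' : Path a b')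
    (q : Path b' c) (h : s.comp r = s'.comp q) :
    (∃ t : Path b b', r = t.comp q) ∨ ∃ t : Path b' b, q = t.comp r := by
  induction r generalizing b' with
  | nil => exact Or.inr ⟨q, rfl⟩
  | cons r α ih =>
    cases q with
    | nil => exact Or.inl ⟨_, rfl⟩
    | cons q β =>
      rw [comp_cons, comp_cons] at h
      obtain rfl := obj_eq_of_cons_eq_cons h
      obtain rfl := eq_of_heq (hom_heq_of_cons_eq_cons h)
      obtain ⟨t, ht⟩ | ⟨t, ht⟩ := ih s' q (eq_of_heq (heq_of_cons_eq_cons h))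
      · exact Or.inl ⟨t, by rw [comp_cons, ht]⟩
      · exact Or.inr ⟨t, by rw [comp_cons, ht]⟩

/-- Two right factors of the same length of a path are equal. -/
theorem right_factor_unique {a b b' c : V} (s : Path a b) (r : Path b c) (s' : Path a b')
    (q : Path b' c) (h : s.comp r = s'.comp q) (hl : r.length = q.length) :
    (⟨b, c, r⟩ : QuiverPath V) = ⟨b', c, q⟩ := by
  obtain ⟨d, rfl⟩ | ⟨d, rfl⟩ := right_factor_total _ _ _ _ h <;>
  · rw [length_comp] at hl
    have h0 : d.length = 0 := by omega
    obtain rfl := eq_of_length_zero d h0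
    rw [eq_nil_of_length_zero d h0, nil_comp]

/-- The prefixes of a path, with varying end points. The prefix `p` of the closed path `c` stands
for the infinite path `⋯ccp`. -/
abbrev Prefix (V : Type u) [Quiver.{v} V] (a : V) := Σ b : V, Path a b

section Periodic

variable {a m : V} (c : Path a m) (α : m ⟶ a)

/-- Removing the last arrow from `⋯c'c'p`, where `c' = cα`. -/
def dropLast : Prefix V a → Prefix V a
  | ⟨_, nil⟩ => ⟨m, c⟩
  | ⟨_, cons s _⟩ => ⟨_, s⟩

/-- The last arrow of `⋯c'c'p`, where `c' = cα`. -/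
def lastArrow : (s : Prefix V a) → ((dropLast c s).1 ⟶ s.1)
  | ⟨_, nil⟩ => α
  | ⟨_, cons _ β⟩ => β

/-- The right factor of length `n` of `⋯c'c'p`, where `c' = cα`. -/
def periodicPath : (n : ℕ) → (s : Prefix V a) → Path ((dropLast c)^[n] s).1 s.1
  | 0, _ => nil
  | n + 1, s => (periodicPath n (dropLast c s)).cons (lastArrow c α s)

theorem length_periodicPath (n : ℕ) (s : Prefix V a) : (periodicPath c α n s).length = n := by
  induction n generalizing s with
  | zero => rfl
  | succ n ih => exact congrArg (· + 1) (ih _)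

/-- The starting vertices of `t` and of the periodic path agree only after rewriting an iterate of
`dropLast`, so the second equality is stated in `QuiverPath`. -/
theorem periodicPath_add (m' n : ℕ) (s : Prefix V a) :
    ∃ t : Path ((dropLast c)^[m' + n] s).1 ((dropLast c)^[n] s).1,
      periodicPath c α (m' + n) s = t.comp (periodicPath c α n s) ∧
      (⟨_, _, t⟩ : QuiverPath V) = ⟨_, _, periodicPath c α m' ((dropLast c)^[n] s)⟩ := by
  induction n generalizing s with
  | zero => exact ⟨periodicPath c α m' s, rfl, rfl⟩
  | succ n ih =>
    obtain ⟨t, h1, h2⟩ := ih (dropLast c s)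
    exact ⟨t, congrArg (fun p => Path.cons p (lastArrow c α s)) h1, h2⟩

/-- The right factors of a periodic path are periodic paths. -/
theorem eq_periodicPath_of_comp_eq {n : ℕ} {s : Prefix V a} {b e : V} (t : Path e b)
    (r : Path b s.1) (h : (⟨_, _, periodicPath c α n s⟩ : QuiverPath V) = ⟨_, _, t.comp r⟩) :
    (⟨_, _, r⟩ : QuiverPath V) = ⟨_, _, periodicPath c α r.length s⟩ := by
  obtain ⟨m', rfl⟩ : ∃ m', n = m' + r.length := by
    have hlen := congrArg (fun p : QuiverPath V => p.path.length) h
    simp only [length_periodicPath, length_comp] at hlen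
    exact ⟨t.length, hlen⟩
  obtain ⟨t', ht', -⟩ := periodicPath_add c α m' r.length s
  have hr := length_periodicPath c α r.length s
  obtain rfl : _ = e := congrArg QuiverPath.src h
  simp only [QuiverPath.mk.injEq, heq_eq_eq, true_and] at h
  rw [ht'] at h
  exact right_factor_unique _ _ _ _ h.symm hr.symm

theorem iterate_dropLast_length {b : V} (s : Path a b) :
    (dropLast c)^[s.length] ⟨b, s⟩ = ⟨a, nil⟩ := by
  induction s with
  | nil => rfl
  | cons s β ih => exact ih

theorem iterate_dropLast_add_length (x : ℕ) :
    (dropLast c)^[x + (c.length + 1)] ⟨a, nil⟩ = (dropLast c)^[x] ⟨a, nil⟩ := by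
  rw [Function.iterate_add_apply]
  -- One removal from the empty prefix wraps around to `c`, and `c.length` more exhaust it; hence
  -- the period `c.length + 1`.
  exact congrArg _ (iterate_dropLast_length c c)

/-- The interval `[x, y)` of the periodic path `⋯c'c'`, where `c' = cα` and positions are counted
from the right. -/
def interval (x y : ℕ) : QuiverPath V :=
  ⟨_, _, c.periodicPath α (y - x) (c.dropLast^[x] ⟨a, .nil⟩)⟩

theorem src_interval {x y : ℕ} (h : x ≤ y) :
    (interval c α x y).src = (c.dropLast^[y] ⟨a, .nil⟩).1 := by
  change (c.dropLast^[y - x] (c.dropLast^[x] _)).1 = _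
  rw [← Function.iterate_add_apply, Nat.sub_add_cancel h]

theorem interval_add_length (x y : ℕ) :
    interval c α (x + (c.length + 1)) (y + (c.length + 1)) = interval c α x y := by
  unfold interval
  rw [iterate_dropLast_add_length, Nat.add_sub_add_right]

end Periodic

end Quiver.Path

/-! ### Coefficients of paths and ideals generated by paths. -/

namespace PathAlgebra

noncomputable section

variable {k : Type w} [Field k] {V : Type u} [Quiver.{v} V]

/-- The coefficient of a path in an element of the path algebra. -/
def coeff (r : QuiverPath V) : PathAlgebra k V →ₗ[k] k :=
  (Finsupp.lapply r : (QuiverPath V →₀ k) →ₗ[k] k)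

theorem coeff_ofQuiverPath_self (r : QuiverPath V) : coeff r (ofQuiverPath k r) = 1 :=
  Finsupp.single_eq_same

theorem coeff_ofQuiverPath_of_ne {r s : QuiverPath V} (h : r ≠ s) :
    coeff r (ofQuiverPath k s) = 0 :=
  Finsupp.single_eq_of_ne h

theorem mem_span_ofQuiverPath {T : Set (QuiverPath V)} {x : PathAlgebra k V}
    (h : ∀ r, coeff r x ≠ 0 → r ∈ T) : x ∈ Submodule.span k (ofQuiverPath k '' T) := by
  have hx : x ∈ Finsupp.supported k k T := fun r hr => h r (Finsupp.mem_support_iff.1 hr)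
  rw [Finsupp.supported_eq_span_single] at hx
  exact hx

@[elab_as_elim]
theorem path_induction {P : PathAlgebra k V → Prop} (x : PathAlgebra k V)
    (hp : ∀ r, P (ofQuiverPath k r)) (h0 : P 0) (hadd : ∀ x y, P x → P y → P (x + y))
    (hsmul : ∀ (t : k) x, P x → P (t • x)) : P x := by
  have hx : x ∈ Submodule.span k (ofQuiverPath k '' Set.univ) :=
    mem_span_ofQuiverPath fun _ _ => Set.mem_univ _
  induction hx using Submodule.span_induction with
  | mem x hx => obtain ⟨r, -, rfl⟩ := hx; exact hp r
  | zero => exact h0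
  | add x y _ _ hx hy => exact hadd x y hx hy
  | smul t x _ hx => exact hsmul t x hx

variable [DecidableEq V] [Fintype V]

theorem ofQuiverPath_mul_mem_or (p q : QuiverPath V) :
    ofQuiverPath k p * ofQuiverPath k q = 0 ∨
      ∃ r, ofQuiverPath k p * ofQuiverPath k q = ofQuiverPath k r := by
  rw [ofQuiverPath_mul, pathMul]
  split_ifs
  · exact Or.inr ⟨_, rfl⟩
  · exact Or.inl rfl

/-- An ideal that is generated by paths is spanned by the paths that it contains. -/
theorem IsGeneratedByPaths.mem_span {I : TwoSidedIdeal (PathAlgebra k V)}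
    (hI : IsGeneratedByPaths I) {x : PathAlgebra k V} (hx : x ∈ I) :
    x ∈ Submodule.span k (ofQuiverPath k '' {r | ofQuiverPath k r ∈ I}) := by
  -- A product of two paths is a path or zero, so this span is itself a two-sided ideal; it contains
  -- the generators of `I`.
  set M := Submodule.span k (ofQuiverPath k '' {r | ofQuiverPath k r ∈ I}) with hM
  have hl : ∀ y z : PathAlgebra k V, z ∈ M → y * z ∈ M := by
    intro y z hz
    induction y using path_induction with
    | hp r =>
      induction hz using Submodule.span_induction with
      | mem z hz =>
        obtain ⟨s, hs, rfl⟩ := hz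
        have hrs := I.mul_mem_left (ofQuiverPath k r) _ hs
        obtain h | ⟨t, h⟩ := ofQuiverPath_mul_mem_or (k := k) r s
        · rw [h]; exact zero_mem _
        · rw [h] at hrs ⊢; exact Submodule.subset_span ⟨t, hrs, rfl⟩
      | zero => rw [mul_zero]; exact zero_mem _
      | add z z' _ _ h h' => rw [mul_add]; exact add_mem h h'
      | smul t z _ h => rw [mul_smul_comm]; exact M.smul_mem t h
    | h0 => rw [zero_mul]; exact zero_mem _
    | hadd y y' h h' => rw [add_mul]; exact add_mem h h'
    | hsmul t y h => rw [smul_mul_assoc]; exact M.smul_mem t h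
  have hr : ∀ y z : PathAlgebra k V, z ∈ M → z * y ∈ M := by
    intro y z hz
    induction y using path_induction with
    | hp r =>
      induction hz using Submodule.span_induction with
      | mem z hz =>
        obtain ⟨s, hs, rfl⟩ := hz
        have hrs := I.mul_mem_right _ (ofQuiverPath k r) hs
        obtain h | ⟨t, h⟩ := ofQuiverPath_mul_mem_or (k := k) s r
        · rw [h]; exact zero_mem _
        · rw [h] at hrs ⊢; exact Submodule.subset_span ⟨t, hrs, rfl⟩
      | zero => rw [zero_mul]; exact zero_mem _
      | add z z' _ _ h h' => rw [add_mul]; exact add_mem h h'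
      | smul t z _ h => rw [smul_mul_assoc]; exact M.smul_mem t h
    | h0 => rw [mul_zero]; exact zero_mem _
    | hadd y y' h h' => rw [mul_add]; exact add_mem h h'
    | hsmul t y h => rw [mul_smul_comm]; exact M.smul_mem t h
  obtain ⟨S, hS⟩ := hI
  let J : TwoSidedIdeal (PathAlgebra k V) :=
    .mk' M M.zero_mem M.add_mem M.neg_mem (hl _ _) (hr _ _)
  have hJ : ∀ x, x ∈ J ↔ x ∈ M := TwoSidedIdeal.mem_mk' _ _ _ _ _ _
  have hIJ : I ≤ J := by
    conv_lhs => rw [hS]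
    rw [TwoSidedIdeal.span_le]
    rintro _ ⟨s, hs, rfl⟩
    have : ofQuiverPath k s ∈ I := by
      rw [hS]; exact TwoSidedIdeal.subset_span ⟨s, hs, rfl⟩
    exact (hJ _).2 (Submodule.subset_span ⟨s, this, rfl⟩)
  exact (hJ x).1 (hIJ hx)

/-- The coefficient of a path outside `I` vanishes on every path in `I`, and these span `I`. -/
theorem IsGeneratedByPaths.ofQuiverPath_mem {I : TwoSidedIdeal (PathAlgebra k V)}
    (hI : IsGeneratedByPaths I) {x : PathAlgebra k V} (hx : x ∈ I) {r : QuiverPath V}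
    (hr : coeff r x ≠ 0) : ofQuiverPath k r ∈ I := by
  by_contra h
  refine hr ?_
  have hle : Submodule.span k (ofQuiverPath k '' {r | ofQuiverPath k r ∈ I}) ≤
      LinearMap.ker (coeff r) := by
    rw [Submodule.span_le]
    rintro _ ⟨s, hs, rfl⟩
    refine coeff_ofQuiverPath_of_ne ?_
    rintro rfl
    exact h hs
  exact hle (hI.mem_span hx)

/-- Right multiplication by `p` is injective on the paths ending at `b` and kills all others, so
nothing cancels. -/
theorem coeff_mul_ofPath {a b c : V} (r : Quiver.Path a b) (p : Quiver.Path b c)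
    (x : PathAlgebra k V) : coeff ⟨a, c, r.comp p⟩ (x * ofPath k p) = coeff ⟨a, b, r⟩ x := by
  induction x using path_induction with
  | hp s =>
    obtain ⟨a', b', s⟩ := s
    by_cases hb : b' = b
    · subst hb
      have hm : ofQuiverPath k ⟨a', b', s⟩ * ofPath k p = ofPath k (s.comp p) :=
        ofPath_mul_ofPath s p
      rw [hm]
      by_cases h : (⟨a, b', r⟩ : QuiverPath V) = ⟨a', b', s⟩
      · cases h
        rw [ofPath, coeff_ofQuiverPath_self, coeff_ofQuiverPath_self]
      · rw [ofPath, coeff_ofQuiverPath_of_ne h, coeff_ofQuiverPath_of_ne]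
        intro h'
        obtain rfl : a = a' := congrArg QuiverPath.src h'
        simp only [QuiverPath.mk.injEq, heq_eq_eq, true_and, Quiver.Path.comp_inj_left] at h'
        exact h (h' ▸ rfl)
    · have hm : ofQuiverPath k ⟨a', b', s⟩ * ofPath k p = 0 := ofPath_mul_ofPath_of_ne s p hb
      rw [hm, map_zero, coeff_ofQuiverPath_of_ne]
      exact fun h => hb (congrArg QuiverPath.tgt h).symm
  | h0 => rw [zero_mul, map_zero, map_zero]
  | hadd x y hx hy => rw [add_mul, map_add, map_add, hx, hy]
  | hsmul t x hx => rw [smul_mul_assoc, map_smul, map_smul, hx]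

/-- By length, only the trivial path at `b` can contribute `q` to the product. -/
theorem coeff_ofPath_mul {a b : V} (q : Quiver.Path a b) (x : PathAlgebra k V) :
    coeff ⟨a, b, q⟩ (ofPath k q * x) = coeff ⟨b, b, .nil⟩ x := by
  induction x using path_induction with
  | hp s =>
    obtain ⟨b', c, s⟩ := s
    by_cases hb : b = b'
    · subst hb
      have hm : ofPath k q * ofQuiverPath k ⟨b, c, s⟩ = ofPath k (q.comp s) :=
        ofPath_mul_ofPath q s
      rw [hm]
      by_cases h : (⟨b, b, .nil⟩ : QuiverPath V) = ⟨b, c, s⟩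
      · cases h
        rw [Quiver.Path.comp_nil, ofPath, coeff_ofQuiverPath_self, coeff_ofQuiverPath_self]
      · rw [ofPath, coeff_ofQuiverPath_of_ne h, coeff_ofQuiverPath_of_ne]
        intro h'
        obtain rfl : b = c := congrArg QuiverPath.tgt h'
        simp only [QuiverPath.mk.injEq, heq_eq_eq, true_and] at h'
        have hl := congrArg Quiver.Path.length h'
        rw [Quiver.Path.length_comp] at hl
        exact h (by rw [Quiver.Path.eq_nil_of_length_zero s (by omega)])
    · have hm : ofPath k q * ofQuiverPath k ⟨b', c, s⟩ = 0 := ofPath_mul_ofPath_of_ne q s hb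
      rw [hm, map_zero, coeff_ofQuiverPath_of_ne]
      exact fun h => hb (congrArg QuiverPath.src h)
  | h0 => rw [mul_zero, map_zero, map_zero]
  | hadd x y hx hy => rw [mul_add, map_add, map_add, hx, hy]
  | hsmul t x hx => rw [mul_smul_comm, map_smul, map_smul, hx]

/-- The left annihilator of a path modulo an ideal generated by paths is spanned by paths. -/
theorem IsGeneratedByPaths.mem_span_of_mul_mem {I : TwoSidedIdeal (PathAlgebra k V)}
    (hI : IsGeneratedByPaths I) {b c : V} {p : Quiver.Path b c} {x : PathAlgebra k V}
    (hx : x * ofPath k p ∈ I) :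
    x ∈ Submodule.span k (ofQuiverPath k '' {r | ofQuiverPath k r * ofPath k p ∈ I}) := by
  refine mem_span_ofQuiverPath fun ⟨a, b', r⟩ hr => ?_
  by_cases hb : b' = b
  · subst hb
    rw [← coeff_mul_ofPath r p] at hr
    change ofPath k r * ofPath k p ∈ I
    rw [ofPath_mul_ofPath]
    exact hI.ofQuiverPath_mem hx hr
  · change ofPath k r * ofPath k p ∈ I
    rw [ofPath_mul_ofPath_of_ne r p hb]
    exact I.zero_mem

/-! ### The projection onto the left ideal of a path. -/

open Classical in
/-- The projection of the path algebra onto the span of the paths with right factor `q`. -/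
def rightFactorProj (k : Type w) [Field k] {a b : V} (q : Quiver.Path a b) :
    PathAlgebra k V →ₗ[k] PathAlgebra k V :=
  (Finsupp.linearCombination k fun r : QuiverPath V =>
    if ∃ (a' : V) (t : Quiver.Path a' a), r = ⟨a', b, t.comp q⟩ then ofQuiverPath k r else 0 :
      (QuiverPath V →₀ k) →ₗ[k] PathAlgebra k V)

section rightFactorProj

variable {a b : V} (q : Quiver.Path a b)

theorem rightFactorProj_of_factor {a' : V} (t : Quiver.Path a' a) :
    rightFactorProj k q (ofPath k (t.comp q)) = ofPath k (t.comp q) := by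
  refine (Finsupp.linearCombination_single k 1 _).trans ?_
  rw [one_smul, if_pos ⟨a', t, rfl⟩]
  rfl

theorem rightFactorProj_of_not_factor {r : QuiverPath V}
    (h : ¬ ∃ (a' : V) (t : Quiver.Path a' a), r = ⟨a', b, t.comp q⟩) :
    rightFactorProj k q (ofQuiverPath k r) = 0 := by
  refine (Finsupp.linearCombination_single k 1 _).trans ?_
  rw [one_smul, if_neg h]

theorem exists_mul_eq_rightFactorProj (x : PathAlgebra k V) :
    ∃ y, y * ofPath k q = rightFactorProj k q x := by
  induction x using path_induction with
  | hp r =>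
    by_cases h : ∃ (a' : V) (t : Quiver.Path a' a), r = ⟨a', b, t.comp q⟩
    · obtain ⟨a', t, rfl⟩ := h
      exact ⟨ofPath k t, (ofPath_mul_ofPath t q).trans (rightFactorProj_of_factor q t).symm⟩
    · exact ⟨0, by rw [rightFactorProj_of_not_factor q h, zero_mul]⟩
  | h0 => exact ⟨0, by rw [map_zero, zero_mul]⟩
  | hadd x y hx hy =>
    obtain ⟨x', hx⟩ := hx
    obtain ⟨y', hy⟩ := hy
    exact ⟨x' + y', by rw [map_add, add_mul, hx, hy]⟩
  | hsmul t x hx =>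
    obtain ⟨x', hx⟩ := hx
    exact ⟨t • x', by rw [map_smul, smul_mul_assoc, hx]⟩

theorem rightFactorProj_mul_ofPath (x : PathAlgebra k V) :
    rightFactorProj k q (x * ofPath k q) = x * ofPath k q := by
  induction x using path_induction with
  | hp r =>
    obtain ⟨a', b', r⟩ := r
    by_cases h : b' = a
    · subst h
      have hm : ofQuiverPath k ⟨a', b', r⟩ * ofPath k q = ofPath k (r.comp q) :=
        ofPath_mul_ofPath r q
      rw [hm, rightFactorProj_of_factor]
    · have hm : ofQuiverPath k ⟨a', b', r⟩ * ofPath k q = 0 := ofPath_mul_ofPath_of_ne r q h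
      rw [hm, map_zero]
  | h0 => rw [zero_mul, map_zero]
  | hadd x y hx hy => rw [add_mul, map_add, hx, hy]
  | hsmul t x hx => rw [smul_mul_assoc, map_smul, hx]

/-- The projection keeps or kills each path, so it respects the span of the paths in `I`. This lets
it descend to the quotient. -/
theorem rightFactorProj_mem {I : TwoSidedIdeal (PathAlgebra k V)} (hI : IsGeneratedByPaths I)
    {x : PathAlgebra k V} (hx : x ∈ I) : rightFactorProj k q x ∈ I := by
  have hx' := hI.mem_span hx
  clear hx
  induction hx' using Submodule.span_induction with
  | mem x hx =>
    obtain ⟨r, hr, rfl⟩ := hx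
    by_cases h : ∃ (a' : V) (t : Quiver.Path a' a), r = ⟨a', b, t.comp q⟩
    · obtain ⟨a', t, rfl⟩ := h
      exact (rightFactorProj_of_factor (k := k) q t).symm ▸ hr
    · rw [rightFactorProj_of_not_factor q h]
      exact I.zero_mem
  | zero => rw [map_zero]; exact I.zero_mem
  | add x y _ _ hx hy => rw [map_add]; exact I.add_mem hx hy
  | smul t x _ hx =>
    rw [map_smul, ← one_mul (rightFactorProj k q x), ← smul_mul_assoc]
    exact I.mul_mem_left _ _ hx

/-- If no proper right factor of `q` annihilates `p` from the left, then the projection onto the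
paths with right factor `q` is linear on the left annihilator of `p`. -/
theorem rightFactorProj_mul {I : TwoSidedIdeal (PathAlgebra k V)} (hI : IsGeneratedByPaths I)
    {c : V} {p : Quiver.Path b c}
    (hq : ∀ (d : V) (t : Quiver.Path a d) (r : Quiver.Path d b), q = t.comp r →
      ofPath k r * ofPath k p ∈ I → t.length = 0)
    (s : PathAlgebra k V) {x : PathAlgebra k V} (hx : x * ofPath k p ∈ I) :
    rightFactorProj k q (s * x) = s * rightFactorProj k q x := by
  have hx' := hI.mem_span_of_mul_mem hx
  clear hx
  induction hx' using Submodule.span_induction with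
  | mem x hx =>
    obtain ⟨⟨d, e, r⟩, hr, rfl⟩ := hx
    by_cases h : ∃ (a' : V) (t : Quiver.Path a' a), (⟨d, e, r⟩ : QuiverPath V) = ⟨a', b, t.comp q⟩
    · obtain ⟨a', t, h⟩ := h
      have hm : ofQuiverPath k ⟨d, e, r⟩ = ofPath k t * ofPath k q := by
        rw [h, ofPath_mul_ofPath]; rfl
      rw [hm, ← mul_assoc, rightFactorProj_mul_ofPath, rightFactorProj_mul_ofPath, mul_assoc]
    · rw [rightFactorProj_of_not_factor q h, mul_zero]
      induction s using path_induction with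
      | hp s =>
        obtain ⟨d', e', s⟩ := s
        by_cases he : e' = d
        · subst he
          have hm : ofQuiverPath k ⟨d', e', s⟩ * ofQuiverPath k ⟨e', e, r⟩ =
              ofQuiverPath k ⟨d', e, s.comp r⟩ := ofPath_mul_ofPath s r
          rw [hm]
          refine rightFactorProj_of_not_factor q ?_
          rintro ⟨a', t, h'⟩
          obtain rfl : d' = a' := congrArg QuiverPath.src h'
          obtain rfl : e = b := congrArg QuiverPath.tgt h'
          simp only [QuiverPath.mk.injEq, heq_eq_eq, true_and] at h'
          -- Both `r` and `q` are right factors of one path. Either `q` is a right factor of `r`, or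
          -- `r` is one of `q` and minimality gives `r = q`; both contradict `h`.
          obtain ⟨t', ht'⟩ | ⟨t', ht'⟩ := Quiver.Path.right_factor_total _ _ _ _ h'
          · exact h ⟨_, t', by rw [ht']⟩
          · have h0 := hq _ t' r ht' hr
            obtain rfl := Quiver.Path.eq_of_length_zero t' h0
            obtain rfl := Quiver.Path.eq_nil_of_length_zero t' h0
            exact h ⟨_, .nil, by rw [ht', Quiver.Path.nil_comp, Quiver.Path.nil_comp]⟩
        · have hm : ofQuiverPath k ⟨d', e', s⟩ * ofQuiverPath k ⟨d, e, r⟩ = 0 :=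
            ofPath_mul_ofPath_of_ne s r he
          rw [hm, map_zero]
      | h0 => rw [zero_mul, map_zero]
      | hadd x y hx hy => rw [add_mul, map_add, hx, hy, add_zero]
      | hsmul t x hx => rw [smul_mul_assoc, map_smul, hx, smul_zero]
  | zero => rw [mul_zero, map_zero, mul_zero]
  | add x y _ _ hx hy => rw [mul_add, map_add, hx, hy, map_add, mul_add]
  | smul t x _ hx => rw [mul_smul_comm, map_smul, hx, map_smul, mul_smul_comm]

end rightFactorProj

end

end PathAlgebra

/-! ### Periodic paths in the path algebra, and syzygies over the quotient. -/

namespace PathAlgebra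

variable {k : Type w} [Field k] {V : Type u} [Quiver.{v} V] [DecidableEq V]

section Periodic

variable {a m : V} (c : Quiver.Path a m) (α : m ⟶ a)

theorem ofPath_periodicPath_add (m' n : ℕ) (s : Quiver.Path.Prefix V a) :
    ofPath k (c.periodicPath α (m' + n) s) =
      ofPath k (c.periodicPath α m' (c.dropLast^[n] s)) * ofPath k (c.periodicPath α n s) := by
  obtain ⟨t, h1, h2⟩ := Quiver.Path.periodicPath_add c α m' n s
  rw [h1, ← ofPath_mul_ofPath, ofPath, h2, ← ofPath]

theorem ofPath_periodicPath_length {b : V} (s : Quiver.Path a b) :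
    ofPath k (c.periodicPath α s.length ⟨b, s⟩) = ofPath k s := by
  induction s with
  | nil => rfl
  | cons s β ih =>
    rw [← Quiver.Path.comp_toPath_eq_cons s β, ← ofPath_mul_ofPath, ← ih, ofPath_mul_ofPath]
    rfl

theorem ofQuiverPath_interval_mul {x y z : ℕ} (hxy : x ≤ y) (hyz : y ≤ z) :
    ofQuiverPath k (c.interval α y z) * ofQuiverPath k (c.interval α x y) =
      ofQuiverPath k (c.interval α x z) := by
  obtain ⟨n, rfl⟩ := Nat.exists_eq_add_of_le' hxy
  obtain ⟨m', rfl⟩ := Nat.exists_eq_add_of_le' hyz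
  unfold Quiver.Path.interval
  rw [Nat.add_sub_cancel, Nat.add_sub_cancel, ← add_assoc, Nat.add_sub_cancel,
    Function.iterate_add_apply _ n x]
  exact (ofPath_periodicPath_add c α m' n _).symm

theorem ofQuiverPath_interval_zero_length :
    ofQuiverPath k (c.interval α 0 (c.length + 1)) = ofPath k (c.cons α) :=
  ofPath_periodicPath_length c α (c.cons α)

end Periodic

variable [Fintype V]

theorem mk'_eq_zero_iff {I : TwoSidedIdeal (PathAlgebra k V)} {x : PathAlgebra k V} :
    I.ringCon.mk' x = 0 ↔ x ∈ I := by
  rw [← TwoSidedIdeal.mem_ker, TwoSidedIdeal.ker_ringCon_mk']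

/-- If `q` is minimal among the paths that annihilate `p` from the left, then the left ideal
generated by `q` is a direct summand of a syzygy of the left ideal generated by `p`. -/
theorem IsGeneratedByPaths.hasProjectiveDimensionLT_of_minimal
    {I : TwoSidedIdeal (PathAlgebra k V)} (hI : IsGeneratedByPaths I) {a b c : V}
    {q : Quiver.Path a b} {p : Quiver.Path b c} (hqp : ofPath k q * ofPath k p ∈ I)
    (hq : ∀ (d : V) (t : Quiver.Path a d) (r : Quiver.Path d b), q = t.comp r →
      ofPath k r * ofPath k p ∈ I → t.length = 0) {n : ℕ}
    (h : HasProjectiveDimensionLT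
      (ModuleCat.of I.ringCon.Quotient (principalLeftIdeal (I.ringCon.mk' (ofPath k p)))) (n + 2)) :
    HasProjectiveDimensionLT
      (ModuleCat.of I.ringCon.Quotient (principalLeftIdeal (I.ringCon.mk' (ofPath k q))))
      (n + 1) := by
  have hsurj : Function.Surjective I.ringCon.mk' := I.ringCon.mk'_surjective
  -- The projection on arbitrary lifts; `hf` shows that the choice of lift is irrelevant.
  let f : I.ringCon.Quotient → I.ringCon.Quotient := fun x =>
    I.ringCon.mk' (rightFactorProj k q (Function.surjInv hsurj x))
  have hf : ∀ x, f (I.ringCon.mk' x) = I.ringCon.mk' (rightFactorProj k q x) := by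
    intro x
    rw [← sub_eq_zero, ← map_sub, ← map_sub]
    refine mk'_eq_zero_iff.2 (rightFactorProj_mem q hI (mk'_eq_zero_iff.1 ?_))
    rw [map_sub, Function.surjInv_eq hsurj, sub_self]
  refine hasProjectiveDimensionLT_principalLeftIdeal_of_retract ?_ f ?_ ?_ ?_ ?_ h
  · rw [← map_mul]
    exact mk'_eq_zero_iff.2 hqp
  · intro x y
    obtain ⟨x, rfl⟩ := hsurj x
    obtain ⟨y, rfl⟩ := hsurj y
    rw [← map_add, hf, hf, hf, map_add, map_add]
  · intro s x hx
    obtain ⟨x, rfl⟩ := hsurj x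
    obtain ⟨s, rfl⟩ := hsurj s
    rw [← map_mul] at hx
    rw [← map_mul, hf, hf, ← map_mul, rightFactorProj_mul q hI hq s (mk'_eq_zero_iff.1 hx)]
  · intro x
    obtain ⟨y, hy⟩ := exists_mul_eq_rightFactorProj q (Function.surjInv hsurj x)
    exact ⟨I.ringCon.mk' y, by rw [← map_mul, hy]⟩
  · intro x
    obtain ⟨x, rfl⟩ := hsurj x
    rw [← map_mul, hf, rightFactorProj_mul_ofPath]

/-- The left ideal generated by a nonzero path that is annihilated from the left by a nonzero path
is not projective. -/
theorem IsGeneratedByPaths.not_projective_of_mul_mem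
    {I : TwoSidedIdeal (PathAlgebra k V)} (hI : IsGeneratedByPaths I) {a b c : V}
    {q : Quiver.Path a b} {p : Quiver.Path b c} (hqp : ofPath k q * ofPath k p ∈ I)
    (hq : ofPath k q ∉ I) (hp : ofPath k p ∉ I) :
    ¬ Projective
      (ModuleCat.of I.ringCon.Quotient (principalLeftIdeal (I.ringCon.mk' (ofPath k p)))) := by
  intro h
  obtain ⟨u, hu, hann⟩ := exists_mul_eq_self_of_projective_principalLeftIdeal h
  obtain ⟨u, rfl⟩ := I.ringCon.mk'_surjective u
  have hqu := hann (I.ringCon.mk' (ofPath k q)) (by rw [← map_mul]; exact mk'_eq_zero_iff.2 hqp)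
  rw [← map_mul] at hqu
  rw [← map_mul, ← sub_eq_zero, ← map_sub] at hu
  -- This is the coefficient of `q` in `q * u`, which lies in `I`, whereas `q` does not.
  have h1 : coeff ⟨b, b, .nil⟩ u = 0 := by
    by_contra h0
    rw [← coeff_ofPath_mul q] at h0
    exact hq (hI.ofQuiverPath_mem (mk'_eq_zero_iff.1 hqu) h0)
  -- In `u * p - p`, an element of `I`, the path `p` then has coefficient -1.
  refine hp (hI.ofQuiverPath_mem (mk'_eq_zero_iff.1 hu) ?_)
  have h2 := coeff_mul_ofPath Quiver.Path.nil p u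
  rw [Quiver.Path.nil_comp, h1] at h2
  rw [map_sub, h2, zero_sub, neg_ne_zero, ofPath, coeff_ofQuiverPath_self]
  exact one_ne_zero

/-- If the quotient by an ideal generated by paths has finite global dimension, then there is no
infinite sequence of nonzero paths each of which is minimal among the paths that annihilate its
predecessor from the left. -/
theorem IsGeneratedByPaths.false_of_minimal_sequence {I : TwoSidedIdeal (PathAlgebra k V)}
    (hI : IsGeneratedByPaths I) (hgl : globalDimension I.ringCon.Quotient < ⊤)
    (p : ℕ → QuiverPath V) (hp : ∀ i, ofQuiverPath k (p i) ∉ I)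
    (hcomp : ∀ i, (p (i + 1)).tgt = (p i).src)
    (hmul : ∀ i, ofQuiverPath k (p (i + 1)) * ofQuiverPath k (p i) ∈ I)
    (hmin : ∀ i (d : V) (t : Quiver.Path (p (i + 1)).src d)
      (r : Quiver.Path d (p (i + 1)).tgt), (p (i + 1)).path = t.comp r →
      ofPath k r * ofQuiverPath k (p i) ∈ I → t.length = 0) : False := by
  obtain ⟨n, hn⟩ := exists_projectiveDimensionLT_of_globalDimension_lt_top hgl
  suffices ∀ n i, ¬ HasProjectiveDimensionLT (ModuleCat.of I.ringCon.Quotient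
      (principalLeftIdeal (I.ringCon.mk' (ofQuiverPath k (p i))))) (n + 1) from this n 0 (hn _)
  clear hn n
  intro n
  induction n with
  | zero =>
    intro i h
    have h1 := hp i
    have h2 := hp (i + 1)
    have h3 := hcomp i
    have h4 := hmul i
    generalize p (i + 1) = q at *
    generalize p i = p at *
    obtain ⟨a, b, q⟩ := q
    obtain ⟨b', c, p⟩ := p
    obtain rfl : b = b' := h3
    exact hI.not_projective_of_mul_mem (q := q) (p := p) h4 h2 h1
      (projective_iff_hasProjectiveDimensionLT_one.2 h)
  | succ n ih =>
    intro i h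
    refine ih (i + 1) ?_
    have h3 := hcomp i
    have h4 := hmul i
    have h5 := hmin i
    generalize p (i + 1) = q at *
    generalize p i = p at *
    obtain ⟨a, b, q⟩ := q
    obtain ⟨b', c, p⟩ := p
    obtain rfl : b = b' := h3
    exact hI.hasProjectiveDimensionLT_of_minimal (q := q) (p := p) h4 h5 h

/-- In a monomial algebra of finite global dimension the square of every closed path of positive
length is zero. -/
theorem IsMonomial.ofPath_sq_mem {I : TwoSidedIdeal (PathAlgebra k V)} (hI : IsMonomial I)
    (hgl : globalDimension I.ringCon.Quotient < ⊤) {a : V} {c : Quiver.Path a a}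
    (hc : 0 < c.length) : (ofPath k c) ^ 2 ∈ I := by
  obtain ⟨⟨t, -, ht, -⟩, hI⟩ := hI
  by_contra hsq
  cases c with
  | nil => exact absurd hc (lt_irrefl _)
  | cons c α =>
  -- The clause `x ≤ y` in `Z` excludes the trivial paths that truncated subtraction yields for y <
  -- x.
  obtain ⟨e, he, hZ⟩ := exists_strictMono_minimal_intervals (ℓ := c.length + 1)
    (Nat.succ_pos _) (Z := fun x y => x ≤ y ∧ ofQuiverPath k (c.interval α x y) ∈ I)
    (fun hx hxy hy h => by
      refine ⟨hx.trans (hxy.trans hy), ?_⟩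
      rw [← ofQuiverPath_interval_mul c α hx (hxy.trans hy),
        ← ofQuiverPath_interval_mul c α hxy hy]
      exact I.mul_mem_right _ _ (I.mul_mem_left _ _ h.2))
    (fun h => h.1)
    (fun x y => by rw [Quiver.Path.interval_add_length, Nat.add_le_add_iff_right])
    ⟨t, Nat.zero_le _, ht (TwoSidedIdeal.subset_span
      ⟨_, _, (c.interval α 0 t).path, Quiver.Path.length_periodicPath c α _ _, rfl⟩)⟩
    (fun h => hsq (by
      have h2 := Quiver.Path.interval_add_length c α 0 (c.length + 1)
      rw [zero_add, ← two_mul] at h2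
      rw [pow_two, ← ofQuiverPath_interval_zero_length]
      nth_rw 1 [← h2]
      rw [ofQuiverPath_interval_mul c α (Nat.zero_le _) (by omega)]
      exact h.2))
  have hlt : ∀ i, e i < e (i + 1) := fun i => he (Nat.lt_succ_self i)
  refine hI.false_of_minimal_sequence hgl (fun i => c.interval α (e i) (e (i + 1)))
    (fun i h => (hZ i).2 _ (hlt (i + 1)) ⟨(hlt i).le, h⟩)
    (fun i => (Quiver.Path.src_interval c α (hlt i).le).symm) (fun i => ?_) fun i d t r htr hr => ?_
  · rw [ofQuiverPath_interval_mul c α (hlt i).le (hlt (i + 1)).le]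
    exact (hZ i).1.2
  · have hl := congrArg Quiver.Path.length htr
    rw [Quiver.Path.length_comp] at hl
    have hl' : _ = e (i + 2) - e (i + 1) := Quiver.Path.length_periodicPath c α
      (e (i + 2) - e (i + 1)) (c.dropLast^[e (i + 1)] ⟨a, .nil⟩)
    replace hl : e (i + 2) - e (i + 1) = t.length + r.length := hl'.symm.trans hl
    -- The right factor `r` is an initial piece of the interval, counted from the right. So its
    -- product with the preceding interval is again an interval from `e i`; lying in `I`, it cannot
    -- end before `e (i + 2)`.
    have hr' : (⟨_, _, r⟩ : QuiverPath V) =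
        c.interval α (e (i + 1)) (e (i + 1) + r.length) := by
      unfold Quiver.Path.interval
      rw [Nat.add_sub_cancel_left]
      refine Quiver.Path.eq_periodicPath_of_comp_eq c α t r (n := e (i + 2) - e (i + 1)) ?_
      exact congrArg (fun p => (⟨_, _, p⟩ : QuiverPath V)) htr
    rw [ofPath, hr', ofQuiverPath_interval_mul c α (hlt i).le (Nat.le_add_right _ _)] at hr
    by_contra h0
    have := hlt i
    have := hlt (i + 1)
    exact (hZ i).2 _ (by omega) ⟨by omega, hr⟩

end PathAlgebra

theorem corollary4 {k : Type w} [Field k] {V : Type u} [Quiver.{v} V]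
    [Fintype V] [DecidableEq V] [∀ a b : V, Finite (a ⟶ b)]
    (I : TwoSidedIdeal (PathAlgebra k V)) (hI : PathAlgebra.IsMonomial I)
    (hgl : globalDimension I.ringCon.Quotient < ⊤)
    (a : V) (c : Quiver.Path a a) (hc : 0 < c.length) :
    (PathAlgebra.ofPath k c) ^ 2 ∈ I :=
  hI.ofPath_sq_mem hgl hc
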